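/- Let $d\in\mathbb N$. For a polynomial $Q(z)=\sum_\alpha c_\alpha z^\alpha\in\mathbb C[z_1,\dots,z_d]$ write $Q^*(z)=\sum_\alpha\overline{c_\alpha}z^\alpha$, $Q(D)=\sum_\alpha c_\alpha\,\partial_{z_1}^{\alpha_1}\cdots\partial_{z_d}^{\alpha_d}$, and $\|Q\|_a=\bigl(\sum_\alpha \alpha!\,|c_\alpha|^2\bigr)^{1/2}$ (the apolar norm). The order of an entire function $\varphi:\mathbb C^d\to\mathbb C$ is $\limsup_{r\to\infty}\frac{\log\log M(\varphi,r)}{\log r}$, where $M(\varphi,r)=\sup_{|z|=r}|\varphi(z)|$ and $|z|$ is the Euclidean norm (constant functions have order $0$). Let $k\ge 2$ and $0\le\beta_1\le\beta_2\le k-1$, and let $P\in\mathbb C[z_1,\dots,z_d]$ be a polynomial of degree $k$ with expansion $P=P_{\beta_1}+\cdots+P_{\beta_2}+P_k$ into homogeneous components ($P_j$ being homogeneous of degree $j$), where $P_{\beta_1}\ne0$, $P_{\beta_2}\ne 0$ and possibly $\beta_1=\beta_2$. Suppose that there are real constants $0\le\tau\le k-1$ and $C>0$ such that $$\|P_k g_m\|_a\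 \ge\ C\,(m+1)^{\tau/2}\,\|g_m\|_a$$ for all integers $m\ge0$ and all homogeneous polynomials $g_m$ of degree $m$. Put $$b=\frac{2(k-\beta_2)}{k-\tau}\ \text{ if }\beta_2\ge\tau,\qquad b=\frac{2(k-\beta_1)}{k+\beta_2-\beta_1-\tau}\ \text{ if }\beta_2<\tau .$$ If $\varphi:\mathbb C^d\to\mathbb C$ is an entire function of order $\rho<b$ with $P_k^*(D)(P\varphi)=0$, then $\varphi=0$. Consequently, the Fischer operator $\varphi\mapsto P_k^*(D)(P\varphi)$ is injective on the set of entire functions of order less than $b$, and Fischer decompositions are unique: if $f=Pq_1+r_1=Pq_2+r_2$ with $q_1,q_2,r_1,r_2$ entire, $q_1,q_2$ of order less than $b$, and $P_k^*(D)r_1=P_k^*(D)r_2=0$, then $q_1=q_2$ and $r_1=r_2$. -/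

import Mathlib

noncomputable section

namespace FischerUniqueness

/-- Complex Euclidean space `ℂ^d`, with the norm `|z| = √(|z₁|² + ⋯ + |z_d|²)`. -/
abbrev Cd (d : ℕ) : Type := EuclideanSpace ℂ (Fin d)

/-- The value `P(z)` of a polynomial at a point of `ℂ^d`. -/
def evalAt {d : ℕ} (P : MvPolynomial (Fin d) ℂ) (z : Cd d) : ℂ :=
  MvPolynomial.eval (fun i => z i) P

/-- `P^*`: the polynomial whose coefficients are the complex conjugates of those of `P`. -/
def conjPoly {d : ℕ} (P : MvPolynomial (Fin d) ℂ) : MvPolynomial (Fin d) ℂ :=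
  MvPolynomial.map (starRingEnd ℂ) P

/-- The complex partial derivative `∂f/∂z_i`. -/
def partialDeriv {d : ℕ} (i : Fin d) (f : Cd d → ℂ) : Cd d → ℂ :=
  fun z => fderiv ℂ f z (EuclideanSpace.single i 1)

/-- The iterated partial derivative `D^α f = ∂₁^{α₁} ⋯ ∂_d^{α_d} f`. -/
def multiDeriv {d : ℕ} (α : Fin d →₀ ℕ) (f : Cd d → ℂ) : Cd d → ℂ :=
  (List.finRange d).foldr (fun i g => (partialDeriv i)^[α i] g) f

/-- The constant coefficient differential operator `Q(D)`, obtained from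
`Q = ∑ c_α z^α` by replacing `z^α` with `D^α`. -/
def diffOp {d : ℕ} (Q : MvPolynomial (Fin d) ℂ) (f : Cd d → ℂ) : Cd d → ℂ :=
  fun z => ∑ α ∈ Q.support, Q.coeff α * multiDeriv α f z

/-- The Fischer operator `F_{QP}(φ) = Q(D)(P φ)`. -/
def fischerOp {d : ℕ} (Q P : MvPolynomial (Fin d) ℂ) (φ : Cd d → ℂ) : Cd d → ℂ :=
  diffOp Q (fun z => evalAt P z * φ z)

/-- The apolar inner product `⟨P, Q⟩_a = ∑_α α! c_α conj(d_α)`. -/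
def apolarInner {d : ℕ} (P Q : MvPolynomial (Fin d) ℂ) : ℂ :=
  ∑ α ∈ P.support, ((∏ i, (α i).factorial : ℕ) : ℂ) * P.coeff α * (starRingEnd ℂ) (Q.coeff α)

/-- The apolar norm `‖P‖_a = √⟨P, P⟩_a`. -/
def apolarNorm {d : ℕ} (P : MvPolynomial (Fin d) ℂ) : ℝ :=
  Real.sqrt (apolarInner P P).re

/-- The maximum modulus `M(f, r) = sup {|f(z)| : |z| = r}`. -/
def maxModulus {d : ℕ} (f : Cd d → ℂ) (r : ℝ) : ℝ :=
  sSup ((fun z => ‖f z‖) '' Metric.sphere (0 : Cd d) r)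

/-- The order `limsup_{r → ∞} log log M(f, r) / log r` of an entire function, an extended real
number. For a constant function, where `log log M` need not make sense, the conventions for
`Real.log` give the usual value `0`. -/
def entireOrder {d : ℕ} (f : Cd d → ℂ) : EReal :=
  Filter.limsup
    (fun r : ℝ => ((Real.log (Real.log (maxModulus f r)) / Real.log r : ℝ) : EReal))
    Filter.atTop

/-- The bound on the order: `2(k-β₂)/(k-τ)` if `β₂ ≥ τ`, and
`2(k-β₁)/(k+β₂-β₁-τ)` if `β₂ < τ`. -/
def orderBound (k β₁ β₂ : ℕ) (τ : ℝ) : ℝ :=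
  if τ ≤ (β₂ : ℝ) then 2 * ((k : ℝ) - β₂) / ((k : ℝ) - τ)
  else 2 * ((k : ℝ) - β₁) / ((k : ℝ) + β₂ - β₁ - τ)

/-- The entire functions on `ℂ^d` of order less than `b`. -/
def entireOfOrderLT (d : ℕ) (b : ℝ) : Set (Cd d → ℂ) :=
  {φ | Differentiable ℂ φ ∧ entireOrder φ < (b : EReal)}

end FischerUniqueness

end

/-! ### Regularity of entire functions of several variables. -/

namespace FischerUniqueness

open MeasureTheory Metric

/-! Write `f_n` for the degree-`n` Taylor part of a solution. Since `⟨f_N, q⟩_a = (q^*(D) f)(0)`,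
the equation `P_k^*(D)(P f) = 0` says that every homogeneous part of `P f` is apolar to the
multiples of `P_k` (`apolarInner_homPart_taylor_eq_zero`). The part of degree `n + k` is `P_k f_n +
∑_j P_j f_{n+k-j}`. Pairing it with `P_k f_n` and applying Cauchy–Schwarz gives `‖P_k f_n‖ ≤ ∑_j
‖P_j f_{n+k-j}‖` (`apolarNorm_homPart_le`).

On the left the hypothesis supplies the factor `(n+1)^{τ/2}`. On the right, multiplication by `P_j`
costs at most a constant times `(n+1)^{j/2}` (`apolarNorm_mul_le`). Each `‖f_n‖` is thus controlled
by later terms, with polynomial loss.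

Growth `exp(|z|^ρ)` forces `‖f_n‖ ≤ A B^n n!^{1/2-1/ρ}` by Cauchy's estimates
(`apolarNorm_homPart_taylor_le`). Put `c = 1/b - 1/2`. As `ρ < b`, the weighted sequence `‖f_n‖ n!^c
L^n` is bounded for every `L`. The bound `b` satisfies `(j-τ)/2 ≤ c(k-j)` for all `j` that occur, so
`n!^c` absorbs the polynomial loss; a large `L` then turns the recursion into `sup ≤ sup/2`, and
everything vanishes (`eq_zero_of_recursive_le`). -/

/-- The derivative of an entire function is bounded on closed balls. -/
theorem exists_norm_fderiv_le {d : ℕ} {f : Cd d → ℂ} (hf : Differentiable ℂ f) (z₀ : Cd d)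
    (R : ℝ) : ∃ B, ∀ z ∈ closedBall z₀ R, ‖fderiv ℂ f z‖ ≤ B := by
  obtain ⟨M, hM⟩ := (isCompact_closedBall z₀ (R + 1)).exists_bound_of_continuousOn
    hf.continuous.continuousOn
  refine ⟨(M + M) / 1, fun z hz => ?_⟩
  have hz' : dist z z₀ ≤ R := hz
  -- Cauchy's estimate on the unit ball about `z`, which `f` maps into the ball of radius `2M` about
  -- `f z`.
  refine Complex.norm_fderiv_le_div_of_mapsTo_ball hf.differentiableOn ?_ one_pos
  intro w hw
  have hw' : dist w z < 1 := hw
  rw [mem_closedBall, dist_eq_norm]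
  refine (norm_sub_le _ _).trans (add_le_add (hM _ ?_) (hM _ ?_))
  · rw [mem_closedBall]
    linarith [dist_triangle w z z₀]
  · rw [mem_closedBall]
    linarith

/-- The directional derivative as a Cauchy integral over the unit circle. -/
theorem fderiv_apply_eq_integral {d : ℕ} {f : Cd d → ℂ} (hf : Differentiable ℂ f) (v z : Cd d) :
    fderiv ℂ f z v = (2 * Real.pi * Complex.I)⁻¹ * ∫ θ in Set.Ioc 0 (2 * Real.pi),
      (deriv (circleMap 0 1) θ * (1 / (circleMap 0 1 θ) ^ 2)) * f (z + circleMap 0 1 θ • v) := by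
  have hg : Differentiable ℂ fun t : ℂ => f (z + t • v) := by fun_prop
  have h := (hg.differentiableOn (s := closedBall 0 1)).deriv_eq_smul_circleIntegral one_pos
  have hd : deriv (fun t : ℂ => f (z + t • v)) 0 = fderiv ℂ f z v := by
    have h1 : HasDerivAt (fun t : ℂ => z + t • v) v 0 := by
      simpa using ((hasDerivAt_id (0 : ℂ)).smul_const v).const_add z
    have h2 : HasFDerivAt f (fderiv ℂ f z) (z + (0 : ℂ) • v) := by
      simpa using (hf z).hasFDerivAt
    exact (h2.comp_hasDerivAt (0 : ℂ) h1).deriv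
  rw [hd, circleIntegral, intervalIntegral.integral_of_le Real.two_pi_pos.le] at h
  rw [eq_inv_mul_iff_mul_eq₀ Complex.two_pi_I_ne_zero]
  simpa [mul_assoc] using h.symm

/-- The contour in the Cauchy integral does not depend on `z`, so one may differentiate under the
integral sign. -/
theorem differentiable_fderiv_apply {d : ℕ} {f : Cd d → ℂ} (hf : Differentiable ℂ f) (v : Cd d) :
    Differentiable ℂ fun z => fderiv ℂ f z v := by
  have hfun : (fun z => fderiv ℂ f z v) = fun z => (2 * Real.pi * Complex.I)⁻¹ *
      ∫ θ in Set.Ioc 0 (2 * Real.pi),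
      (deriv (circleMap 0 1) θ * (1 / (circleMap 0 1 θ) ^ 2)) * f (z + circleMap 0 1 θ • v) :=
    funext fun z => fderiv_apply_eq_integral hf v z
  rw [hfun]
  refine Differentiable.const_mul (fun z₀ => ?_) _
  have hw : Continuous fun θ : ℝ => deriv (circleMap 0 1) θ * (1 / (circleMap 0 1 θ) ^ 2) := by
    simp only [deriv_circleMap]
    refine Continuous.mul (by fun_prop) (Continuous.div (by fun_prop) (by fun_prop) fun θ => ?_)
    simp
  have hwn : ∀ θ : ℝ, ‖deriv (circleMap 0 1) θ * (1 / (circleMap 0 1 θ) ^ 2)‖ = 1 := by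
    intro θ
    simp [deriv_circleMap]
  -- Radius `1` for the motion of `z` near `z₀`, plus `‖v‖` for the displacement along the circle.
  obtain ⟨B, hB⟩ := exists_norm_fderiv_le hf z₀ (1 + ‖v‖)
  refine (hasFDerivAt_integral_of_dominated_of_fderiv_le (𝕜 := ℂ) (s := ball z₀ 1)
    (bound := fun _ => B)
    (F' := fun z θ => (deriv (circleMap 0 1) θ * (1 / (circleMap 0 1 θ) ^ 2)) •
      fderiv ℂ f (z + circleMap 0 1 θ • v))
    (ball_mem_nhds _ one_pos) ?_ ?_ ?_ ?_ ?_ ?_).differentiableAt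
  · refine Filter.Eventually.of_forall fun z => Continuous.aestronglyMeasurable ?_
    exact hw.mul (hf.continuous.comp (by fun_prop))
  · refine (Continuous.integrableOn_Icc ?_).mono_set Set.Ioc_subset_Icc_self
    exact hw.mul (hf.continuous.comp (by fun_prop))
  · have hm : Measurable fun θ : ℝ => fderiv ℂ f (z₀ + circleMap 0 1 θ • v) :=
      (measurable_fderiv ℂ f).comp (Continuous.measurable (by fun_prop))
    exact hw.aestronglyMeasurable.smul hm.aestronglyMeasurable
  · refine Filter.Eventually.of_forall fun θ z hz => ?_
    rw [norm_smul, hwn, one_mul]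
    refine hB _ ?_
    rw [mem_closedBall, dist_eq_norm]
    calc ‖z + circleMap 0 1 θ • v - z₀‖ = ‖(z - z₀) + circleMap 0 1 θ • v‖ := by congr 1; abel
      _ ≤ ‖z - z₀‖ + ‖circleMap 0 1 θ • v‖ := norm_add_le _ _
      _ ≤ 1 + ‖v‖ := by
        rw [norm_smul]
        have : ‖z - z₀‖ < 1 := by simpa [dist_eq_norm] using hz
        simp only [norm_circleMap_zero, abs_one, one_mul]
        linarith
  · exact integrable_const _
  · refine Filter.Eventually.of_forall fun θ z _ => ?_
    have h := (hf (z + circleMap 0 1 θ • v)).hasFDerivAt.comp z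
      ((hasFDerivAt_id z).add_const (circleMap 0 1 θ • v))
    exact h.const_smul (deriv (circleMap 0 1) θ * (1 / (circleMap 0 1 θ) ^ 2))

theorem differentiable_partialDeriv {d : ℕ} {f : Cd d → ℂ} (hf : Differentiable ℂ f) (i : Fin d) :
    Differentiable ℂ (partialDeriv i f) :=
  differentiable_fderiv_apply hf _

theorem differentiable_fderiv {d : ℕ} {f : Cd d → ℂ} (hf : Differentiable ℂ f) :
    Differentiable ℂ (fderiv ℂ f) := by
  have h : fderiv ℂ f = fun z => ∑ i, partialDeriv i f z •
      (EuclideanSpace.proj i : Cd d →L[ℂ] ℂ) := by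
    funext z
    ext v
    conv_lhs => rw [← (EuclideanSpace.basisFun (Fin d) ℂ).sum_repr v]
    simp [partialDeriv, mul_comm]
  rw [h]
  exact Differentiable.fun_sum fun i _ => (differentiable_partialDeriv hf i).smul_const _

theorem partialDeriv_comm {d : ℕ} {f : Cd d → ℂ} (hf : Differentiable ℂ f) (i j : Fin d) :
    partialDeriv i (partialDeriv j f) = partialDeriv j (partialDeriv i f) := by
  have h : ∀ a b : Fin d, ∀ z, partialDeriv a (partialDeriv b f) z =
      fderiv ℂ (fderiv ℂ f) z (EuclideanSpace.single a 1) (EuclideanSpace.single b 1) := by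
    intro a b z
    have := ((differentiable_fderiv hf z).hasFDerivAt.clm_apply
      (hasFDerivAt_const (EuclideanSpace.single b (1 : ℂ)) z)).fderiv
    unfold partialDeriv
    rw [this]
    simp
  funext z
  rw [h, h]
  exact second_derivative_symmetric (fun y => (hf y).hasFDerivAt)
    (differentiable_fderiv hf z).hasFDerivAt _ _

end FischerUniqueness

/-! ### Differential and multiplication operators as endomorphisms of the space of entire functions.
-/

noncomputable section

namespace FischerUniqueness

open Metric

/-- The space of entire functions on `ℂ^d`. -/
def entire (d : ℕ) : Submodule ℂ (Cd d → ℂ) where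
  carrier := {f | Differentiable ℂ f}
  add_mem' hf hg := hf.add hg
  zero_mem' := differentiable_const 0
  smul_mem' c _ hf := hf.const_smul c

/-- The partial derivative as an endomorphism of the space of entire functions. -/
def pderiv {d : ℕ} (i : Fin d) : Module.End ℂ (entire d) where
  toFun f := ⟨partialDeriv i f, differentiable_partialDeriv f.2 i⟩
  map_add' f g := by
    ext z
    simp [partialDeriv, fderiv_add (f.2 z) (g.2 z)]
  map_smul' c f := by
    ext z
    simp [partialDeriv, fderiv_const_smul (f.2 z) c]

theorem coe_pderiv_pow {d : ℕ} (i : Fin d) (n : ℕ) (f : entire d) :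
    ((pderiv i ^ n) f : Cd d → ℂ) = (partialDeriv i)^[n] f := by
  induction n with
  | zero => rfl
  | succ n ih =>
    rw [pow_succ', Function.iterate_succ_apply', ← ih]
    rfl

theorem pderiv_commute {d : ℕ} (i j : Fin d) : Commute (pderiv i) (pderiv j) := by
  ext f z
  exact congrFun (partialDeriv_comm f.2 i j) z

/-- The product of the powers `∂_i ^ α_i` along a list of coordinates. -/
def listDeriv {d : ℕ} (L : List (Fin d)) (α : Fin d →₀ ℕ) : Module.End ℂ (entire d) :=
  (L.map fun i => pderiv i ^ α i).prod

theorem listDeriv_nil {d : ℕ} (α : Fin d →₀ ℕ) : listDeriv [] α = 1 := rfl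

theorem listDeriv_cons {d : ℕ} (i : Fin d) (L : List (Fin d)) (α : Fin d →₀ ℕ) :
    listDeriv (i :: L) α = pderiv i ^ α i * listDeriv L α := by
  simp [listDeriv]

theorem pderiv_commute_listDeriv {d : ℕ} (i : Fin d) (L : List (Fin d)) (α : Fin d →₀ ℕ) :
    Commute (pderiv i) (listDeriv L α) := by
  refine Commute.list_prod_right _ _ fun D hD => ?_
  obtain ⟨j, -, rfl⟩ := List.mem_map.1 hD
  exact (pderiv_commute i j).pow_right _

theorem listDeriv_add {d : ℕ} (L : List (Fin d)) (α β : Fin d →₀ ℕ) :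
    listDeriv L (α + β) = listDeriv L α * listDeriv L β := by
  induction L with
  | nil => simp [listDeriv_nil]
  | cons i L ih =>
    rw [listDeriv_cons, listDeriv_cons, listDeriv_cons, ih, Finsupp.add_apply, pow_add]
    rw [mul_assoc, mul_assoc, ← mul_assoc (pderiv i ^ β i),
      ((pderiv_commute_listDeriv i L α).pow_left (β i)).eq, mul_assoc]

theorem listDeriv_congr {d : ℕ} {L : List (Fin d)} {α β : Fin d →₀ ℕ} (h : ∀ i ∈ L, α i = β i) :
    listDeriv L α = listDeriv L β := by
  unfold listDeriv
  congr 1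
  exact List.map_congr_left fun i hi => by rw [h i hi]

/-- The iterated partial derivative as an endomorphism of the space of entire functions. -/
def mderiv {d : ℕ} (α : Fin d →₀ ℕ) : Module.End ℂ (entire d) := listDeriv (List.finRange d) α

theorem coe_mderiv {d : ℕ} (α : Fin d →₀ ℕ) (f : entire d) :
    (mderiv α f : Cd d → ℂ) = multiDeriv α f := by
  unfold mderiv multiDeriv
  induction List.finRange d with
  | nil => rfl
  | cons i L ih =>
    rw [listDeriv_cons, List.foldr_cons, ← ih, ← coe_pderiv_pow]
    rfl

/-- The constant coefficient operators, as an algebra homomorphism from polynomials to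
endomorphisms of the space of entire functions. -/
def polyOp {d : ℕ} : MvPolynomial (Fin d) ℂ →ₐ[ℂ] Module.End ℂ (entire d) :=
  AddMonoidAlgebra.lift ℂ (Module.End ℂ (entire d)) (Fin d →₀ ℕ)
    { toFun := fun α => mderiv α.toAdd
      map_one' := by simp [mderiv, listDeriv]
      map_mul' := fun α β => listDeriv_add _ _ _ }

theorem polyOp_apply {d : ℕ} (Q : MvPolynomial (Fin d) ℂ) (f : entire d) :
    polyOp Q f = ∑ α ∈ Q.support, Q.coeff α • mderiv α f := by
  unfold polyOp
  rw [AddMonoidAlgebra.lift_apply, Finsupp.sum, LinearMap.sum_apply]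
  rfl

theorem coe_polyOp {d : ℕ} (Q : MvPolynomial (Fin d) ℂ) (f : entire d) :
    (polyOp Q f : Cd d → ℂ) = diffOp Q f := by
  funext z
  rw [polyOp_apply, diffOp]
  simp [coe_mderiv]

theorem differentiable_evalAt {d : ℕ} (P : MvPolynomial (Fin d) ℂ) :
    Differentiable ℂ (evalAt P) := by
  unfold evalAt
  induction P using MvPolynomial.induction_on with
  | C a => simp
  | add p q hp hq => simpa using Differentiable.fun_add hp hq
  | mul_X p i hp =>
    simp only [map_mul, MvPolynomial.eval_X]
    exact Differentiable.fun_mul hp (by fun_prop)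

/-- Multiplication by a polynomial on the space of entire functions. -/
def mulPoly {d : ℕ} (P : MvPolynomial (Fin d) ℂ) : Module.End ℂ (entire d) where
  toFun f := ⟨fun z => evalAt P z * f.1 z, (differentiable_evalAt P).mul f.2⟩
  map_add' f g := by ext z; simp [mul_add]
  map_smul' c f := by ext z; simp [mul_left_comm]

theorem mulPoly_apply {d : ℕ} (P : MvPolynomial (Fin d) ℂ) (f : entire d) (z : Cd d) :
    (mulPoly P f).1 z = evalAt P z * f.1 z := rfl

theorem partialDeriv_coord_mul {d : ℕ} (i j : Fin d) {f : Cd d → ℂ} (hf : Differentiable ℂ f)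
    (z : Cd d) : partialDeriv j (fun z => z i * f z) z =
      z i * partialDeriv j f z + (if i = j then f z else 0) := by
  have h1 : HasFDerivAt (fun z : Cd d => z i) (EuclideanSpace.proj i : Cd d →L[ℂ] ℂ) z :=
    (EuclideanSpace.proj i : Cd d →L[ℂ] ℂ).hasFDerivAt
  unfold partialDeriv
  rw [(h1.fun_mul (hf z).hasFDerivAt).fderiv]
  by_cases h : i = j <;> simp [h]

theorem pderiv_mul_mulPoly_X_self {d : ℕ} (i : Fin d) :
    pderiv i * mulPoly (.X i) = mulPoly (.X i) * pderiv i + 1 := by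
  ext f z
  have := partialDeriv_coord_mul i i f.2 z
  simpa [pderiv, mulPoly, evalAt] using this

theorem pderiv_commute_mulPoly_X {d : ℕ} {i j : Fin d} (h : i ≠ j) :
    Commute (pderiv j) (mulPoly (.X i)) := by
  ext f z
  have := partialDeriv_coord_mul i j f.2 z
  simpa [pderiv, mulPoly, evalAt, h] using this

theorem pderiv_pow_mul_mulPoly_X {d : ℕ} (i : Fin d) (n : ℕ) :
    pderiv i ^ n * mulPoly (.X i) = mulPoly (.X i) * pderiv i ^ n + n • pderiv i ^ (n - 1) := by
  induction n with
  | zero => simp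
  | succ n ih =>
    rw [pow_succ', mul_assoc, ih, mul_add, ← mul_assoc, pderiv_mul_mulPoly_X_self, add_mul,
      mul_assoc, ← pow_succ', one_mul, add_assoc, mul_smul_comm]
    congr 1
    -- The truncated exponent `n - 1` at `n = 0` is harmless, as its coefficient is `0`.
    rcases n with _ | n
    · simp
    · rw [← pow_succ']
      simp only [Nat.add_sub_cancel]
      rw [add_comm, ← succ_nsmul]

theorem listDeriv_commute_mulPoly_X {d : ℕ} {i : Fin d} {L : List (Fin d)} (h : i ∉ L)
    (α : Fin d →₀ ℕ) : Commute (listDeriv L α) (mulPoly (.X i)) := by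
  refine Commute.list_prod_left _ _ fun D hD => ?_
  obtain ⟨j, hj, rfl⟩ := List.mem_map.1 hD
  have hij : i ≠ j := fun hij => h (hij ▸ hj)
  exact (pderiv_commute_mulPoly_X hij).pow_left _

theorem listDeriv_mul_mulPoly_X {d : ℕ} {i : Fin d} {L : List (Fin d)} (hL : L.Nodup)
    (hi : i ∈ L) (α : Fin d →₀ ℕ) :
    listDeriv L α * mulPoly (.X i) =
      mulPoly (.X i) * listDeriv L α + α i • listDeriv L (α - Finsupp.single i 1) := by
  induction L with
  | nil => simp at hi
  | cons j L ih =>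
    obtain ⟨hj, hL⟩ := List.nodup_cons.1 hL
    rw [listDeriv_cons, listDeriv_cons]
    by_cases hij : i = j
    · subst hij
      have h1 : listDeriv L (α - Finsupp.single i 1) = listDeriv L α :=
        listDeriv_congr fun l hl => by
          have : i ≠ l := fun h => hj (h ▸ hl)
          simp [this]
      rw [mul_assoc, (listDeriv_commute_mulPoly_X hj α).eq, ← mul_assoc,
        pderiv_pow_mul_mulPoly_X, h1]
      simp [add_mul, mul_assoc]
    · have h2 : (α - Finsupp.single i 1 : Fin d →₀ ℕ) j = α j := by simp [hij]
      rw [mul_assoc, ih hL (by simpa [hij] using hi), mul_add, ← mul_assoc,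
        ((pderiv_commute_mulPoly_X hij).pow_left (α j)).eq, h2, mul_smul_comm,
        mul_assoc]

/-- Leibniz's rule for a coordinate function; evaluated at `0` it makes the Taylor series compatible
with multiplication by polynomials. -/
theorem mderiv_mulPoly_X {d : ℕ} (i : Fin d) (α : Fin d →₀ ℕ) (f : entire d) :
    mderiv α (mulPoly (.X i) f) =
      mulPoly (.X i) (mderiv α f) + α i • mderiv (α - Finsupp.single i 1) f := by
  have := listDeriv_mul_mulPoly_X (List.nodup_finRange d) (List.mem_finRange i) α
  exact LinearMap.congr_fun this f

/-! ### Cauchy estimates and the identity theorem, one coordinate at a time. -/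

theorem iteratedDeriv_slice {d : ℕ} (f : entire d) (i : Fin d) (w : Cd d) (n : ℕ) :
    iteratedDeriv n (fun t : ℂ => f.1 (w + t • EuclideanSpace.single i 1)) =
      fun t => ((pderiv i ^ n) f).1 (w + t • EuclideanSpace.single i 1) := by
  induction n with
  | zero => simp
  | succ n ih =>
    rw [iteratedDeriv_succ, ih, pow_succ']
    funext t
    have h1 : HasDerivAt (fun t : ℂ => w + t • EuclideanSpace.single i (1 : ℂ))
        (EuclideanSpace.single i 1) t := by
      simpa using ((hasDerivAt_id t).smul_const (EuclideanSpace.single i (1 : ℂ))).const_add w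
    exact ((((pderiv i ^ n) f).2 _).hasFDerivAt.comp_hasDerivAt t h1).deriv

theorem differentiable_slice {d : ℕ} (f : entire d) (i : Fin d) (w : Cd d) :
    Differentiable ℂ (fun t : ℂ => f.1 (w + t • EuclideanSpace.single i 1)) :=
  f.2.comp (by fun_prop)

/-- Cauchy's estimate for iterated partial derivatives. -/
theorem norm_listDeriv_le {d : ℕ} (f : entire d) (α : Fin d →₀ ℕ) {r M : ℝ} (hr : 0 < r)
    (L : List (Fin d)) (R : ℝ) (hM : ∀ z : Cd d, ‖z‖ ≤ R + L.length * r → ‖f.1 z‖ ≤ M)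
    (z : Cd d) (hz : ‖z‖ ≤ R) :
    ‖(listDeriv L α f).1 z‖ ≤ (L.map fun i => ((α i).factorial / r ^ α i : ℝ)).prod * M := by
  induction L generalizing R z with
  | nil => simpa [listDeriv] using hM z (by simpa using hz)
  | cons i L ih =>
    rw [listDeriv_cons, List.map_cons, List.prod_cons]
    have hslice := iteratedDeriv_slice (listDeriv L α f) i z (α i)
    have h0 := congrFun hslice 0
    simp only [zero_smul, add_zero] at h0
    rw [Module.End.mul_apply, ← h0]
    refine (Complex.norm_iteratedDeriv_le_of_forall_mem_sphere_norm_le (α i) hr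
      (differentiable_slice _ i z).diffContOnCl (C := (L.map fun i =>
        ((α i).factorial / r ^ α i : ℝ)).prod * M) fun t ht => ?_).trans (le_of_eq (by ring))
    -- Each coordinate treated enlarges the ball by one circle radius `r`.
    refine ih (R + r) (fun y hy => hM y ?_) _ ?_
    · simp only [List.length_cons]
      push_cast
      linarith
    · refine (norm_add_le _ _).trans (add_le_add hz ?_)
      rw [norm_smul]
      simpa using le_of_eq ht

theorem norm_mderiv_le {d : ℕ} (f : entire d) (α : Fin d →₀ ℕ) {r M : ℝ} (hr : 0 < r)
    (hM : ∀ z : Cd d, ‖z‖ ≤ d * r → ‖f.1 z‖ ≤ M) :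
    ‖(mderiv α f).1 0‖ ≤ (∏ i, (α i).factorial : ℕ) / r ^ α.degree * M := by
  refine (norm_listDeriv_le f α hr (List.finRange d) 0 (by simpa using hM) 0
    (by simp)).trans (le_of_eq ?_)
  congr 1
  rw [← List.ofFn_eq_map, List.prod_ofFn, Finset.prod_div_distrib, Finset.prod_pow_eq_pow_sum,
    Finsupp.degree_eq_sum]
  push_cast
  rfl

/-- Induction on the coordinates still frozen at zero: the one-variable Taylor series in `z_i`
propagates vanishing from the subspace `z_i = 0` to the larger subspace where `z_i` is free. -/
theorem eq_zero_of_listDeriv_eq_zero {d : ℕ} (f : entire d) {L : List (Fin d)} (hL : L.Nodup)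
    (h : ∀ α, ∀ z : Cd d, (∀ i ∈ L, z i = 0) → (listDeriv L α f).1 z = 0) : f = 0 := by
  induction L with
  | nil =>
    ext z
    exact h 0 z (by simp)
  | cons i L ih =>
    obtain ⟨hi, hL⟩ := List.nodup_cons.1 hL
    refine ih hL fun α z hz => ?_
    set g := listDeriv L α f with hg
    set w : Cd d := z - z i • EuclideanSpace.single i 1 with hw
    have hw0 : ∀ j ∈ i :: L, w j = 0 := by
      intro j hj
      rcases List.mem_cons.1 hj with rfl | hj
      · simp [hw]
      · have : j ≠ i := fun e => hi (e ▸ hj)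
        simp [hw, this, hz j hj]
    have hder : ∀ n, iteratedDeriv n (fun t : ℂ => g.1 (w + t • EuclideanSpace.single i 1)) 0
        = 0 := by
      intro n
      rw [iteratedDeriv_slice]
      -- Since `i ∉ L`, changing the `i`-th exponent to `n` leaves the derivatives along `L` alone.
      have h1 := h (α.update i n) w hw0
      rw [listDeriv_cons, listDeriv_congr (β := α) (fun j hj => by
        have : j ≠ i := fun e => hi (e ▸ hj)
        simp [this])] at h1
      simpa using h1
    have hs := (Complex.hasSum_taylorSeries_of_entire (differentiable_slice g i w) 0 (z i))
    simp only [hder, smul_zero] at hs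
    have := hs.unique hasSum_zero
    simpa [hw] using this

theorem eq_zero_of_mderiv_eq_zero {d : ℕ} (f : entire d) (h : ∀ α, (mderiv α f).1 0 = 0) :
    f = 0 := by
  refine eq_zero_of_listDeriv_eq_zero f (List.nodup_finRange d) fun α z hz => ?_
  have : z = 0 := by
    ext i
    exact hz i (List.mem_finRange i)
  rw [this]
  exact h α

end FischerUniqueness

end

/-! ### The apolar norm and multiplication by homogeneous polynomials. -/

noncomputable section

namespace FischerUniqueness

open MvPolynomial

theorem degree_eq_of_coeff_ne_zero {d m : ℕ} {p : MvPolynomial (Fin d) ℂ}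
    (hp : p.IsHomogeneous m) {α : Fin d →₀ ℕ} (hα : p.coeff α ≠ 0) : α.degree = m := by
  rw [Finsupp.degree_eq_weight_one]
  exact hp hα

/-- The multi-index factorial `α! = α₁! ⋯ α_d!`. -/
def multiFactorial {d : ℕ} (α : Fin d →₀ ℕ) : ℕ := ∏ i, (α i).factorial

theorem multiFactorial_pos {d : ℕ} (α : Fin d →₀ ℕ) : 0 < multiFactorial α :=
  Finset.prod_pos fun _ _ => Nat.factorial_pos _

theorem multiFactorial_add_single {d : ℕ} (α : Fin d →₀ ℕ) (i : Fin d) :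
    multiFactorial (α + Finsupp.single i 1) = (α i + 1) * multiFactorial α := by
  unfold multiFactorial
  rw [← Finset.mul_prod_erase _ _ (Finset.mem_univ i),
    ← Finset.mul_prod_erase _ (fun i => (α i).factorial) (Finset.mem_univ i), ← mul_assoc]
  congr 1
  · simp [Nat.factorial_succ]
  · refine Finset.prod_congr rfl fun j hj => ?_
    have : i ≠ j := (Finset.ne_of_mem_erase hj).symm
    simp [this]

theorem multiFactorial_le {d : ℕ} (α : Fin d →₀ ℕ) :
    multiFactorial α ≤ α.degree.factorial := by
  rw [Finsupp.degree_eq_sum]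
  exact Nat.le_of_dvd (Nat.factorial_pos _) (Nat.prod_factorial_dvd_factorial_sum _ _)

theorem multiFactorial_add_le {d : ℕ} (α γ : Fin d →₀ ℕ) :
    multiFactorial (α + γ) ≤ (α.degree + γ.degree) ^ γ.degree * multiFactorial α := by
  have h : ∀ i, (α i + γ i).factorial ≤ (α.degree + γ.degree) ^ γ i * (α i).factorial := by
    intro i
    rw [← Nat.factorial_mul_ascFactorial, mul_comm]
    refine Nat.mul_le_mul_right _ ((Nat.ascFactorial_le_pow_add _ _).trans ?_)
    exact Nat.pow_le_pow_left (add_le_add (Finsupp.le_degree i α) (Finsupp.le_degree i γ)) _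
  calc multiFactorial (α + γ) ≤ ∏ i, (α.degree + γ.degree) ^ γ i * (α i).factorial :=
        Finset.prod_le_prod' fun i _ => h i
    _ = _ := by
      rw [Finset.prod_mul_distrib, Finset.prod_pow_eq_pow_sum, ← Finsupp.degree_eq_sum]
      rfl

theorem apolarInner_eq_sum {d : ℕ} {p : MvPolynomial (Fin d) ℂ} (q : MvPolynomial (Fin d) ℂ)
    {s : Finset (Fin d →₀ ℕ)} (hs : p.support ⊆ s) :
    apolarInner p q = ∑ α ∈ s, (multiFactorial α : ℂ) * p.coeff α * starRingEnd ℂ (q.coeff α) := by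
  refine Finset.sum_subset hs fun α _ hα => ?_
  simp [notMem_support_iff.1 hα]

theorem apolarInner_add_left {d : ℕ} (p q r : MvPolynomial (Fin d) ℂ) :
    apolarInner (p + q) r = apolarInner p r + apolarInner q r := by
  classical
  rw [apolarInner_eq_sum r support_add,
    apolarInner_eq_sum r (Finset.subset_union_left (s₁ := p.support) (s₂ := q.support)),
    apolarInner_eq_sum r (Finset.subset_union_right (s₁ := p.support) (s₂ := q.support)),
    ← Finset.sum_add_distrib]
  exact Finset.sum_congr rfl fun α _ => by rw [coeff_add]; ring

theorem apolarInner_sum_left {d : ℕ} {ι : Type*} (s : Finset ι)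
    (p : ι → MvPolynomial (Fin d) ℂ) (r : MvPolynomial (Fin d) ℂ) :
    apolarInner (∑ i ∈ s, p i) r = ∑ i ∈ s, apolarInner (p i) r :=
  map_sum (AddMonoidHom.mk' (fun p => apolarInner p r) fun p q => apolarInner_add_left p q r) p s

/-- The square of the apolar norm. -/
def apolarSq {d : ℕ} (p : MvPolynomial (Fin d) ℂ) : ℝ :=
  ∑ α ∈ p.support, (multiFactorial α : ℝ) * ‖p.coeff α‖ ^ 2

theorem apolarSq_eq_sum {d : ℕ} {p : MvPolynomial (Fin d) ℂ} {s : Finset (Fin d →₀ ℕ)}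
    (hs : p.support ⊆ s) :
    apolarSq p = ∑ α ∈ s, (multiFactorial α : ℝ) * ‖p.coeff α‖ ^ 2 := by
  refine Finset.sum_subset hs fun α _ hα => ?_
  simp [notMem_support_iff.1 hα]

theorem apolarSq_nonneg {d : ℕ} (p : MvPolynomial (Fin d) ℂ) : 0 ≤ apolarSq p :=
  Finset.sum_nonneg fun _ _ => by positivity

theorem apolarInner_self {d : ℕ} (p : MvPolynomial (Fin d) ℂ) :
    apolarInner p p = (apolarSq p : ℂ) := by
  rw [apolarInner_eq_sum p (le_refl _), apolarSq]
  push_cast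
  refine Finset.sum_congr rfl fun α _ => ?_
  rw [mul_assoc, Complex.mul_conj, Complex.normSq_eq_norm_sq]
  push_cast
  rfl

theorem apolarNorm_eq_sqrt {d : ℕ} (p : MvPolynomial (Fin d) ℂ) :
    apolarNorm p = Real.sqrt (apolarSq p) := by
  rw [apolarNorm, apolarInner_self, Complex.ofReal_re]

theorem apolarNorm_nonneg {d : ℕ} (p : MvPolynomial (Fin d) ℂ) : 0 ≤ apolarNorm p :=
  Real.sqrt_nonneg _

theorem apolarNorm_sq {d : ℕ} (p : MvPolynomial (Fin d) ℂ) : apolarNorm p ^ 2 = apolarSq p := by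
  rw [apolarNorm_eq_sqrt, Real.sq_sqrt (apolarSq_nonneg p)]

theorem eq_zero_of_apolarNorm_eq_zero {d : ℕ} {p : MvPolynomial (Fin d) ℂ}
    (h : apolarNorm p = 0) : p = 0 := by
  have h0 : apolarSq p = 0 := by rw [← apolarNorm_sq, h]; simp
  ext α
  by_contra hα
  have h1 := (Finset.sum_eq_zero_iff_of_nonneg fun _ _ => by positivity).1 h0 α
    (mem_support_iff.2 hα)
  have := multiFactorial_pos α
  simp only [mul_eq_zero, Nat.cast_eq_zero, ne_eq, OfNat.ofNat_ne_zero, not_false_eq_true,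
    pow_eq_zero_iff, norm_eq_zero] at h1
  exact h1.elim this.ne' hα

/-- The Cauchy–Schwarz inequality for the apolar inner product. -/
theorem norm_apolarInner_le {d : ℕ} (p q : MvPolynomial (Fin d) ℂ) :
    ‖apolarInner p q‖ ≤ apolarNorm p * apolarNorm q := by
  classical
  have hp := Finset.subset_union_left (s₁ := p.support) (s₂ := q.support)
  have hq := Finset.subset_union_right (s₁ := p.support) (s₂ := q.support)
  rw [apolarInner_eq_sum q hp, apolarNorm_eq_sqrt, apolarNorm_eq_sqrt, apolarSq_eq_sum hp,
    apolarSq_eq_sum hq]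
  refine (norm_sum_le _ _).trans ?_
  refine le_trans (le_of_eq ?_) ((Real.sum_mul_le_sqrt_mul_sqrt (p.support ∪ q.support)
    (fun α => Real.sqrt (multiFactorial α) * ‖p.coeff α‖)
    (fun α => Real.sqrt (multiFactorial α) * ‖q.coeff α‖)).trans (le_of_eq ?_))
  · refine Finset.sum_congr rfl fun α _ => ?_
    rw [mul_mul_mul_comm, Real.mul_self_sqrt (Nat.cast_nonneg _)]
    simp [mul_assoc]
  · simp [mul_pow]

theorem apolarSq_sum_le {d : ℕ} {ι : Type*} (s : Finset ι) (p : ι → MvPolynomial (Fin d) ℂ) :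
    apolarSq (∑ i ∈ s, p i) ≤ s.card * ∑ i ∈ s, apolarSq (p i) := by
  classical
  have h : ∀ i ∈ s, (p i).support ⊆ s.biUnion fun i => (p i).support := fun i hi =>
    Finset.subset_biUnion_of_mem (fun i => (p i).support) hi
  rw [apolarSq_eq_sum (s := s.biUnion fun i => (p i).support) support_sum,
    Finset.sum_congr rfl fun i hi => apolarSq_eq_sum (h i hi), Finset.sum_comm, Finset.mul_sum]
  refine Finset.sum_le_sum fun α _ => ?_
  rw [← Finset.mul_sum, mul_left_comm, coeff_sum]
  refine mul_le_mul_of_nonneg_left ?_ (Nat.cast_nonneg _)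
  refine (pow_le_pow_left₀ (norm_nonneg _) (norm_sum_le _ _) 2).trans ?_
  exact sq_sum_le_card_mul_sum_sq

/-- Multiplication by a monomial shifts exponents injectively, so no coefficients merge and only the
ratio `(α + γ)! / α!` has to be bounded. -/
theorem apolarSq_monomial_mul_le {d : ℕ} (γ : Fin d →₀ ℕ) (c : ℂ) {m : ℕ}
    {g : MvPolynomial (Fin d) ℂ} (hg : g.IsHomogeneous m) :
    apolarSq (monomial γ c * g) ≤
      ‖c‖ ^ 2 * ((m : ℝ) + γ.degree) ^ γ.degree * apolarSq g := by
  classical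
  have hs : (monomial γ c * g).support ⊆ g.support.map (addLeftEmbedding γ) := by
    refine (support_mul _ _).trans fun α hα => ?_
    obtain ⟨a, ha, b, hb, rfl⟩ := Finset.mem_add.1 hα
    have := Finset.mem_singleton.1 (support_monomial_subset ha)
    subst this
    exact Finset.mem_map.2 ⟨b, hb, rfl⟩
  rw [apolarSq_eq_sum hs, Finset.sum_map, apolarSq, Finset.mul_sum]
  refine Finset.sum_le_sum fun α hα => ?_
  have hdeg : α.degree = m := degree_eq_of_coeff_ne_zero hg (mem_support_iff.1 hα)
  have h := multiFactorial_add_le α γ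
  rw [hdeg] at h
  have h' : (multiFactorial (γ + α) : ℝ) ≤
      ((m : ℝ) + γ.degree) ^ γ.degree * multiFactorial α := by
    rw [add_comm γ]
    exact_mod_cast h
  rw [addLeftEmbedding_apply, coeff_monomial_mul, norm_mul, mul_pow]
  calc (multiFactorial (γ + α) : ℝ) * (‖c‖ ^ 2 * ‖g.coeff α‖ ^ 2)
      ≤ (((m : ℝ) + γ.degree) ^ γ.degree * multiFactorial α) *
        (‖c‖ ^ 2 * ‖g.coeff α‖ ^ 2) := by gcongr
    _ = _ := by ring

/-- Multiplication by a homogeneous polynomial of degree `j` grows at most like the power `j / 2`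
of the degree, in the apolar norm. -/
theorem apolarSq_mul_le {d j : ℕ} {p : MvPolynomial (Fin d) ℂ} (hp : p.IsHomogeneous j) :
    ∃ K : ℝ, 0 ≤ K ∧ ∀ (m : ℕ) (g : MvPolynomial (Fin d) ℂ), g.IsHomogeneous m →
      apolarSq (p * g) ≤ K * ((m : ℝ) + j) ^ j * apolarSq g := by
  refine ⟨p.support.card * ∑ γ ∈ p.support, ‖p.coeff γ‖ ^ 2, by positivity, fun m g hg => ?_⟩
  have h : p * g = ∑ γ ∈ p.support, monomial γ (p.coeff γ) * g := by
    rw [← Finset.sum_mul, ← as_sum p]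
  rw [h]
  refine (apolarSq_sum_le _ _).trans ?_
  rw [mul_assoc, mul_assoc, Finset.sum_mul]
  refine mul_le_mul_of_nonneg_left (Finset.sum_le_sum fun γ hγ => ?_) (Nat.cast_nonneg _)
  have hdeg : γ.degree = j := degree_eq_of_coeff_ne_zero hp (mem_support_iff.1 hγ)
  have := apolarSq_monomial_mul_le γ (p.coeff γ) hg
  rw [hdeg, mul_assoc] at this
  exact this

/-! ### Taylor series, their homogeneous parts, and apolarity. -/

/-- The homogeneous component of degree `m` of a power series, as a polynomial. -/
def homPart {d : ℕ} (m : ℕ) (F : MvPowerSeries (Fin d) ℂ) : MvPolynomial (Fin d) ℂ :=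
  -- Truncation keeps total degrees below `m + 1`, hence all of degree `m`.
  homogeneousComponent m (F.truncTotal (m + 1))

theorem coeff_homPart {d : ℕ} (m : ℕ) (F : MvPowerSeries (Fin d) ℂ) (α : Fin d →₀ ℕ) :
    (homPart m F).coeff α = if α.degree = m then MvPowerSeries.coeff α F else 0 := by
  rw [homPart, coeff_homogeneousComponent]
  split_ifs with h
  · rw [MvPowerSeries.coeff_truncTotal_eq_ite, if_pos (by omega)]
  · rfl

theorem isHomogeneous_homPart {d : ℕ} (m : ℕ) (F : MvPowerSeries (Fin d) ℂ) :
    (homPart m F).IsHomogeneous m :=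
  homogeneousComponent_isHomogeneous _ _

theorem homPart_add {d : ℕ} (m : ℕ) (F G : MvPowerSeries (Fin d) ℂ) :
    homPart m (F + G) = homPart m F + homPart m G := by
  ext α
  simp only [coeff_add, coeff_homPart, map_add]
  split_ifs <;> simp

theorem homPart_sum {d : ℕ} {ι : Type*} (m : ℕ) (s : Finset ι)
    (F : ι → MvPowerSeries (Fin d) ℂ) :
    homPart m (∑ i ∈ s, F i) = ∑ i ∈ s, homPart m (F i) :=
  map_sum (AddMonoidHom.mk' (homPart m) (homPart_add m)) F s

theorem homPart_mul {d j m : ℕ} {p : MvPolynomial (Fin d) ℂ} (hp : p.IsHomogeneous j)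
    (F : MvPowerSeries (Fin d) ℂ) : homPart (m + j) ((p : MvPowerSeries (Fin d) ℂ) * F) = p * homPart m F := by
  classical
  ext α
  rw [coeff_homPart, coeff_mul, MvPowerSeries.coeff_mul]
  by_cases hα : α.degree = m + j
  · rw [if_pos hα]
    refine Finset.sum_congr rfl fun x hx => ?_
    have hx' := Finset.HasAntidiagonal.mem_antidiagonal.1 hx
    rw [MvPolynomial.coeff_coe, coeff_homPart]
    by_cases h0 : p.coeff x.1 = 0
    · simp [h0]
    · have h1 : x.1.degree = j := degree_eq_of_coeff_ne_zero hp h0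
      have h2 : x.1.degree + x.2.degree = α.degree := by rw [← hx', map_add]
      rw [if_pos (by omega)]
  · rw [if_neg hα]
    refine (Finset.sum_eq_zero fun x hx => ?_).symm
    have hx' := Finset.HasAntidiagonal.mem_antidiagonal.1 hx
    by_contra h
    obtain ⟨h3, h4⟩ := mul_ne_zero_iff.1 h
    have h1 : x.1.degree = j := degree_eq_of_coeff_ne_zero hp h3
    have h5 : x.2.degree = m := degree_eq_of_coeff_ne_zero (isHomogeneous_homPart m F) h4
    have h2 : x.1.degree + x.2.degree = α.degree := by rw [← hx', map_add]
    omega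

/-- The Taylor series at the origin of an entire function. -/
def taylor {d : ℕ} (f : entire d) : MvPowerSeries (Fin d) ℂ :=
  fun α => (mderiv α f).1 0 / multiFactorial α

theorem coeff_taylor {d : ℕ} (f : entire d) (α : Fin d →₀ ℕ) :
    MvPowerSeries.coeff α (taylor f) = (mderiv α f).1 0 / multiFactorial α := rfl

theorem mderiv_apply_zero {d : ℕ} (f : entire d) (α : Fin d →₀ ℕ) :
    (mderiv α f).1 0 = multiFactorial α * MvPowerSeries.coeff α (taylor f) := by
  have : (multiFactorial α : ℂ) ≠ 0 := Nat.cast_ne_zero.2 (multiFactorial_pos α).ne'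
  rw [coeff_taylor, mul_div_cancel₀ _ this]

theorem taylor_add {d : ℕ} (f g : entire d) : taylor (f + g) = taylor f + taylor g := by
  ext α
  simp [coeff_taylor, add_div]

theorem taylor_smul {d : ℕ} (c : ℂ) (f : entire d) : taylor (c • f) = c • taylor f := by
  ext α
  simp [coeff_taylor, mul_div_assoc]

theorem taylor_mulPoly_X {d : ℕ} (i : Fin d) (f : entire d) :
    taylor (mulPoly (X i) f) = taylor f * MvPowerSeries.X i := by
  ext α
  have h0 : (mulPoly (X i) (mderiv α f)).1 0 = 0 := by simp [mulPoly_apply, evalAt]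
  have h1 : (mderiv α (mulPoly (X i) f)).1 0 =
      α i * (mderiv (α - Finsupp.single i 1) f).1 0 := by
    rw [mderiv_mulPoly_X]
    change (mulPoly (X i) (mderiv α f)).1 0 + (α i • mderiv (α - Finsupp.single i 1) f).1 0 = _
    rw [h0]
    simp
  rw [coeff_taylor, h1]
  by_cases hα : α i = 0
  · rw [hα, Nat.cast_zero, zero_mul, zero_div, eq_comm, mul_comm, MvPowerSeries.X,
      MvPowerSeries.coeff_monomial_mul, if_neg]
    rw [Finsupp.single_le_iff]
    omega
  · obtain ⟨β, rfl⟩ : ∃ β, α = β + Finsupp.single i 1 :=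
      ⟨α - Finsupp.single i 1, (tsub_add_cancel_of_le (Finsupp.single_le_iff.2 (by omega))).symm⟩
    rw [add_tsub_cancel_right, MvPowerSeries.X, MvPowerSeries.coeff_add_mul_monomial,
      multiFactorial_add_single, mderiv_apply_zero]
    have h2 : (multiFactorial β : ℂ) ≠ 0 := Nat.cast_ne_zero.2 (multiFactorial_pos β).ne'
    have h3 : ((β i : ℂ) + 1) ≠ 0 := Nat.cast_add_one_ne_zero _
    simp
    field_simp

theorem taylor_mulPoly {d : ℕ} (P : MvPolynomial (Fin d) ℂ) (f : entire d) :
    taylor (mulPoly P f) = P * taylor f := by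
  induction P using MvPolynomial.induction_on generalizing f with
  | C a =>
    have : mulPoly (C a) f = a • f := by
      ext z
      simp [mulPoly, evalAt]
    rw [this, taylor_smul, coe_C, MvPowerSeries.smul_eq_C_mul]
  | add p q hp hq =>
    have : mulPoly (p + q) f = mulPoly p f + mulPoly q f := by
      ext z
      simp [mulPoly, evalAt, add_mul]
    rw [this, taylor_add, hp, hq, coe_add, add_mul]
  | mul_X p i hp =>
    have : mulPoly (p * X i) f = mulPoly p (mulPoly (X i) f) := by
      ext z
      simp [mulPoly, evalAt, mul_assoc]
    rw [this, hp, taylor_mulPoly_X, coe_mul, coe_X]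
    ring

theorem eq_zero_of_homPart_taylor_eq_zero {d : ℕ} (f : entire d)
    (h : ∀ m, homPart m (taylor f) = 0) : f = 0 := by
  refine eq_zero_of_mderiv_eq_zero f fun α => ?_
  have h1 := coeff_homPart α.degree (taylor f) α
  rw [h, if_pos rfl, coeff_zero] at h1
  rw [mderiv_apply_zero, ← h1, mul_zero]

theorem conjPoly_mul {d : ℕ} (p q : MvPolynomial (Fin d) ℂ) :
    conjPoly (p * q) = conjPoly p * conjPoly q :=
  map_mul _ _ _

/-- The apolar pairing with a Taylor polynomial is the value at `0` of a derivative. -/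
theorem apolarInner_homPart_taylor {d N : ℕ} (f : entire d) {q : MvPolynomial (Fin d) ℂ}
    (hq : q.IsHomogeneous N) :
    apolarInner (homPart N (taylor f)) q = (polyOp (conjPoly q) f).1 0 := by
  classical
  rw [apolarInner_eq_sum q (Finset.subset_union_left (s₂ := q.support)), polyOp_apply]
  have hs : (conjPoly q).support ⊆ (homPart N (taylor f)).support ∪ q.support :=
    (support_map_subset _ _).trans Finset.subset_union_right
  rw [Finset.sum_subset hs fun α _ hα => by simp [notMem_support_iff.1 hα]]
  rw [AddSubmonoidClass.coe_finsetSum, Finset.sum_apply]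
  refine Finset.sum_congr rfl fun α _ => ?_
  change _ = (conjPoly q).coeff α * (mderiv α f).1 0
  rw [mderiv_apply_zero, conjPoly, coeff_map, coeff_homPart]
  by_cases h0 : q.coeff α = 0
  · simp [h0]
  · rw [if_pos (degree_eq_of_coeff_ne_zero hq h0)]
    ring

/-- If `Q^*(D) f = 0`, then the Taylor polynomials of `f` are apolar to the multiples of `Q`. -/
theorem apolarInner_homPart_taylor_eq_zero {d N : ℕ} {f : entire d}
    {p q : MvPolynomial (Fin d) ℂ} (hpq : (p * q).IsHomogeneous N)
    (h : polyOp (conjPoly p) f = 0) : apolarInner (homPart N (taylor f)) (p * q) = 0 := by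
  -- Commuting the factors lets `p^*(D)` act on `f` first.
  rw [apolarInner_homPart_taylor f hpq, conjPoly_mul, mul_comm, map_mul, Module.End.mul_apply, h,
    map_zero]
  rfl

end FischerUniqueness

end

/-! ### The recursive inequality. -/

noncomputable section

namespace FischerUniqueness

open MvPolynomial

/-- Up to the factor `k^k`, `(n+s)!` is comparable with `n! (n+1)^s`. The sign of `c` decides which
of the two comparisons is needed. -/
theorem rpow_mul_factorial_rpow_le {k s : ℕ} (hs : s ≤ k) (hk : 1 ≤ k) {t c : ℝ}
    (ht : t ≤ c * s) (n : ℕ) :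
    ((n : ℝ) + 1) ^ t * (n.factorial : ℝ) ^ c ≤
      ((k : ℝ) ^ k) ^ |c| * ((n + s).factorial : ℝ) ^ c := by
  have hn : (1 : ℝ) ≤ (n : ℝ) + 1 := by linarith [n.cast_nonneg (α := ℝ)]
  have hk' : (1 : ℝ) ≤ (k : ℝ) ^ k := one_le_pow₀ (by exact_mod_cast hk)
  have hf : (0 : ℝ) < n.factorial := by exact_mod_cast n.factorial_pos
  have h1 : ((n : ℝ) + 1) ^ t * (n.factorial : ℝ) ^ c ≤
      (n.factorial * ((n : ℝ) + 1) ^ s) ^ c := by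
    rw [Real.mul_rpow hf.le (by positivity), mul_comm, ← Real.rpow_natCast_mul (by positivity),
      mul_comm (s : ℝ)]
    gcongr
  refine h1.trans ?_
  rcases le_or_gt 0 c with hc | hc
  · have h2 : (n.factorial : ℝ) * ((n : ℝ) + 1) ^ s ≤ (n + s).factorial := by
      exact_mod_cast Nat.factorial_mul_pow_le_factorial (m := n) (n := s)
    calc _ ≤ ((n + s).factorial : ℝ) ^ c := by gcongr
      _ = 1 * ((n + s).factorial : ℝ) ^ c := (one_mul _).symm
      _ ≤ _ := by
        gcongr
        exact Real.one_le_rpow hk' (abs_nonneg c)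
  · have h2 : ((n + s).factorial : ℝ) ≤ (k : ℝ) ^ k * (n.factorial * ((n : ℝ) + 1) ^ s) := by
      have h3 : (n + s).factorial ≤ n.factorial * (n + s) ^ s := by
        rw [← Nat.factorial_mul_ascFactorial]
        exact Nat.mul_le_mul_left _ (Nat.ascFactorial_le_pow_add _ _)
      have h4 : (n + s) ^ s ≤ k ^ k * (n + 1) ^ s :=
        calc (n + s) ^ s ≤ (k * (n + 1)) ^ s := Nat.pow_le_pow_left (by nlinarith) _
          _ = k ^ s * (n + 1) ^ s := mul_pow _ _ _
          _ ≤ k ^ k * (n + 1) ^ s := Nat.mul_le_mul_right _ (Nat.pow_le_pow_right hk hs)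
      have h5 := h3.trans (Nat.mul_le_mul_left _ h4)
      rw [mul_left_comm] at h5
      exact_mod_cast h5
    have h6 := Real.rpow_le_rpow_of_nonpos (by positivity) h2 hc.le
    rw [Real.mul_rpow (by positivity) (by positivity)] at h6
    rw [abs_of_neg hc]
    calc (n.factorial * ((n : ℝ) + 1) ^ s) ^ c
        = ((k : ℝ) ^ k) ^ (-c) * (((k : ℝ) ^ k) ^ c * (n.factorial * ((n : ℝ) + 1) ^ s) ^ c) := by
          rw [← mul_assoc, ← Real.rpow_add (by positivity)]
          simp
      _ ≤ _ := by gcongr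

/-- A nonnegative sequence which is bounded by later terms through a recursive inequality, and
which decays fast enough, vanishes. -/
theorem eq_zero_of_recursive_le {k : ℕ} {J : Finset ℕ} (hJ : ∀ j ∈ J, j < k)
    {τ c ε K A B : ℝ} (hε : 0 < ε) (hK : 0 ≤ K) (hB : 0 < B)
    (hexp : ∀ j ∈ J, ((j : ℝ) - τ) / 2 ≤ c * (k - j)) {a : ℕ → ℝ} (ha : ∀ n, 0 ≤ a n)
    (hrec : ∀ n : ℕ, ((n : ℝ) + 1) ^ (τ / 2) * a n ≤
      K * ∑ j ∈ J, ((n : ℝ) + 1) ^ ((j : ℝ) / 2) * a (n + (k - j)))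
    (hgrow : ∀ n, a n ≤ A * B ^ n * (n.factorial : ℝ) ^ (-c - ε)) (n : ℕ) : a n = 0 := by
  set E : ℝ := ((k : ℝ) ^ k) ^ |c| with hE
  have hE0 : 0 ≤ E := by positivity
  -- The second entry yields the contraction factor `1/2`; `L ≥ 1` allows one factor `L` to be
  -- gained, since every shift `k - j` is at least `1`.
  set L : ℝ := max 1 (2 * (K * (J.card * E))) with hL
  have hL1 : 1 ≤ L := le_max_left _ _
  have hL0 : 0 < L := by linarith
  have hf : ∀ n : ℕ, (0 : ℝ) < n.factorial := fun n => by exact_mod_cast n.factorial_pos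
  set u : ℕ → ℝ := fun n => a n * (n.factorial : ℝ) ^ c * L ^ n with hu
  have hu0 : ∀ n, 0 ≤ u n := fun n => by
    have := ha n
    positivity
  have hbdd : BddAbove (Set.range u) := by
    refine ⟨|A| * Real.exp ((B * L) ^ (1 / ε)) ^ ε, ?_⟩
    rintro _ ⟨n, rfl⟩
    -- This is `x^n / n! ≤ e^x` at `x = (BL)^{1/ε}`, raised to the power `ε`.
    have h1 : (B * L) ^ n * (n.factorial : ℝ) ^ (-ε) ≤ Real.exp ((B * L) ^ (1 / ε)) ^ ε := by
      have h2 := Real.pow_div_factorial_le_exp ((B * L) ^ (1 / ε)) (by positivity) n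
      refine le_trans (le_of_eq ?_) (Real.rpow_le_rpow (by positivity) h2 hε.le)
      rw [Real.div_rpow (by positivity) (hf n).le, Real.rpow_neg (hf n).le, div_eq_mul_inv,
        ← Real.rpow_natCast ((B * L) ^ (1 / ε)), ← Real.rpow_mul (by positivity),
        ← Real.rpow_mul (by positivity), show 1 / ε * ((n : ℝ) * ε) = n by field_simp,
        Real.rpow_natCast]
    calc u n ≤ (|A| * B ^ n * (n.factorial : ℝ) ^ (-c - ε)) * (n.factorial : ℝ) ^ c * L ^ n := by
          simp only [hu]
          gcongr
          refine (hgrow n).trans ?_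
          gcongr
          exact le_abs_self A
      _ = |A| * ((B * L) ^ n * (n.factorial : ℝ) ^ (-ε)) := by
          rw [show -ε = (-c - ε) + c by ring, Real.rpow_add (hf n)]
          ring
      _ ≤ _ := by gcongr
  set U := ⨆ n, u n with hU
  have huU : ∀ n, u n ≤ U := fun n => le_ciSup hbdd n
  have hU0 : 0 ≤ U := (hu0 0).trans (huU 0)
  have hhalf : ∀ n, u n ≤ U / 2 := by
    intro n
    have hn : (0 : ℝ) < (n : ℝ) + 1 := by positivity
    have hterm : ∀ j ∈ J, ((n : ℝ) + 1) ^ (-(τ / 2)) * (((n : ℝ) + 1) ^ ((j : ℝ) / 2) *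
        a (n + (k - j))) * (n.factorial : ℝ) ^ c * L ^ n ≤ E * U / L := by
      intro j hj
      have hjk := hJ j hj
      have h1 := rpow_mul_factorial_rpow_le (k := k) (s := k - j) (t := ((j : ℝ) - τ) / 2) (c := c)
        (Nat.sub_le _ _) (by omega) (by rw [Nat.cast_sub hjk.le]; exact hexp j hj) n
      have h2 : L ^ n ≤ L ^ (n + (k - j)) / L := by
        rw [le_div_iff₀ hL0, ← pow_succ]
        exact pow_le_pow_right₀ hL1 (by omega)
      have han := ha (n + (k - j))
      calc _ = a (n + (k - j)) * (((n : ℝ) + 1) ^ (((j : ℝ) - τ) / 2) * (n.factorial : ℝ) ^ c) *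
            L ^ n := by
            rw [show ((j : ℝ) - τ) / 2 = -(τ / 2) + (j : ℝ) / 2 by ring, Real.rpow_add hn]
            ring
        _ ≤ a (n + (k - j)) * (E * ((n + (k - j)).factorial : ℝ) ^ c) *
            (L ^ (n + (k - j)) / L) := by gcongr
        _ = E * u (n + (k - j)) / L := by
            simp only [hu]
            ring
        _ ≤ E * U / L := by
            gcongr
            exact huU _
    have h3 : a n ≤ ((n : ℝ) + 1) ^ (-(τ / 2)) * (K * ∑ j ∈ J, ((n : ℝ) + 1) ^ ((j : ℝ) / 2) *
        a (n + (k - j))) := by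
      calc a n = ((n : ℝ) + 1) ^ (-(τ / 2)) * (((n : ℝ) + 1) ^ (τ / 2) * a n) := by
            rw [← mul_assoc, ← Real.rpow_add hn]
            simp
        _ ≤ _ := mul_le_mul_of_nonneg_left (hrec n) (by positivity)
    calc u n ≤ ((n : ℝ) + 1) ^ (-(τ / 2)) * (K * ∑ j ∈ J, ((n : ℝ) + 1) ^ ((j : ℝ) / 2) *
          a (n + (k - j))) * (n.factorial : ℝ) ^ c * L ^ n := by
          simp only [hu]
          gcongr
      _ = K * ∑ j ∈ J, ((n : ℝ) + 1) ^ (-(τ / 2)) * (((n : ℝ) + 1) ^ ((j : ℝ) / 2) *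
          a (n + (k - j))) * (n.factorial : ℝ) ^ c * L ^ n := by
          rw [Finset.mul_sum, Finset.mul_sum, Finset.sum_mul, Finset.sum_mul, Finset.mul_sum]
          exact Finset.sum_congr rfl fun j _ => by ring
      _ ≤ K * ∑ j ∈ J, E * U / L := by
          gcongr with j hj
          exact hterm j hj
      _ = (2 * (K * (J.card * E))) * U / L / 2 := by
          rw [Finset.sum_const, nsmul_eq_mul]
          ring
      _ ≤ L * U / L / 2 := by
          gcongr
          exact le_max_right _ _
      _ = U / 2 := by rw [mul_div_cancel_left₀ _ hL0.ne']
  have hU1 : U ≤ U / 2 := ciSup_le hhalf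
  have hun : u n = 0 := le_antisymm ((huU n).trans (by linarith)) (hu0 n)
  have h1 := (Real.rpow_pos_of_pos (hf n) c).ne'
  have h2 := (pow_pos hL0 n).ne'
  simpa [hu, h1, h2] using hun

/-! ### Order of growth and decay of Taylor coefficients. -/

/-- Growth at most that of `exp (|z| ^ ρ)`. -/
def HasGrowth {d : ℕ} (φ : Cd d → ℂ) (ρ : ℝ) : Prop :=
  ∃ A : ℝ, ∀ z, ‖φ z‖ ≤ A * Real.exp (‖z‖ ^ ρ)

theorem HasGrowth.mono {d : ℕ} {φ : Cd d → ℂ} {ρ σ : ℝ} (h : HasGrowth φ ρ) (hρ : 0 < ρ)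
    (hσ : ρ ≤ σ) : HasGrowth φ σ := by
  obtain ⟨A, hA⟩ := h
  have hA0 : 0 ≤ A := nonneg_of_mul_nonneg_left ((norm_nonneg _).trans (hA 0)) (Real.exp_pos _)
  refine ⟨A * Real.exp 1, fun z => (hA z).trans ?_⟩
  rw [mul_assoc, ← Real.exp_add]
  gcongr
  rcases le_total ‖z‖ 1 with h1 | h1
  · have := Real.rpow_le_one (norm_nonneg z) h1 hρ.le
    have := Real.rpow_nonneg (norm_nonneg z) σ
    linarith
  · have := Real.rpow_le_rpow_of_exponent_le h1 hσ
    linarith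

theorem HasGrowth.sub {d : ℕ} {φ ψ : Cd d → ℂ} {ρ : ℝ} (hφ : HasGrowth φ ρ)
    (hψ : HasGrowth ψ ρ) : HasGrowth (φ - ψ) ρ := by
  obtain ⟨A, hA⟩ := hφ
  obtain ⟨B, hB⟩ := hψ
  refine ⟨A + B, fun z => ?_⟩
  rw [add_mul]
  exact (norm_sub_le _ _).trans (add_le_add (hA z) (hB z))

theorem exists_hasGrowth {d : ℕ} {φ : Cd d → ℂ} (hφ : Continuous φ) {b : ℝ} (hb : 0 < b)
    (h : entireOrder φ < (b : EReal)) : ∃ ρ, 0 < ρ ∧ ρ < b ∧ HasGrowth φ ρ := by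
  -- Taking the maximum with `0` makes `ρ` positive.
  obtain ⟨ρ, hρ1, hρ2⟩ := EReal.lt_iff_exists_real_btwn.1
    (max_lt h (EReal.coe_lt_coe_iff.2 hb) : max (entireOrder φ) ((0 : ℝ) : EReal) < b)
  have hρ0 : 0 < ρ := EReal.coe_lt_coe_iff.1 ((le_max_right _ _).trans_lt hρ1)
  have hev := Filter.eventually_lt_of_limsup_lt ((le_max_left _ _).trans_lt hρ1)
  obtain ⟨R, hR⟩ := Filter.eventually_atTop.1 hev
  obtain ⟨B, hB⟩ := (isCompact_closedBall (0 : Cd d) (max R 2)).exists_bound_of_continuousOn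
    hφ.continuousOn
  refine ⟨ρ, hρ0, EReal.coe_lt_coe_iff.1 hρ2, max 1 B, fun z => ?_⟩
  have hz0 : 0 ≤ ‖z‖ ^ ρ := Real.rpow_nonneg (norm_nonneg z) ρ
  rcases le_or_gt ‖z‖ (max R 2) with hz | hz
  · calc ‖φ z‖ ≤ B := hB z (by simpa using hz)
      _ ≤ max 1 B * 1 := by simp
      _ ≤ _ := by
        gcongr
        exact Real.one_le_exp hz0
  · have hzR : R ≤ ‖z‖ := (le_max_left _ _).trans hz.le
    have hz2 : 2 < ‖z‖ := (le_max_right _ _).trans_lt hz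
    have h1 := EReal.coe_lt_coe_iff.1 (hR _ hzR)
    rw [div_lt_iff₀ (Real.log_pos (by linarith)), ← Real.log_rpow (by linarith)] at h1
    have h2 : Real.log (maxModulus φ ‖z‖) ≤ ‖z‖ ^ ρ := by
      -- When `log M ≤ 0` the iterated logarithm says nothing useful, but the bound is trivial.
      rcases le_or_gt (Real.log (maxModulus φ ‖z‖)) 0 with h3 | h3
      · exact h3.trans hz0
      · exact ((Real.log_lt_log_iff h3 (Real.rpow_pos_of_pos (by linarith) ρ)).1 h1).le
    have h4 : ‖φ z‖ ≤ maxModulus φ ‖z‖ := by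
      refine le_csSup ?_ ⟨z, by simp, rfl⟩
      exact ((isCompact_sphere (0 : Cd d) ‖z‖).image hφ.norm).bddAbove
    calc ‖φ z‖ ≤ maxModulus φ ‖z‖ := h4
      _ ≤ Real.exp (Real.log (maxModulus φ ‖z‖)) := Real.le_exp_log _
      _ ≤ 1 * Real.exp (‖z‖ ^ ρ) := by
        rw [one_mul]
        gcongr
      _ ≤ _ := by
        gcongr
        exact le_max_left _ _

/-- A crude count by `(m+1)^d` is enough: an exponential factor disappears into `B^m`. -/
theorem card_support_le {d m : ℕ} {p : MvPolynomial (Fin d) ℂ} (hp : p.IsHomogeneous m) :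
    p.support.card ≤ (2 ^ d) ^ m := by
  have h : p.support.card ≤ (Fintype.piFinset fun _ : Fin d => Finset.range (m + 1)).card := by
    refine Finset.card_le_card_of_injOn (fun α => ⇑α) (fun α hα => ?_)
      DFunLike.coe_injective.injOn
    refine Finset.mem_coe.2 (Fintype.mem_piFinset.2 fun i => Finset.mem_range.2 ?_)
    have h1 := degree_eq_of_coeff_ne_zero hp (mem_support_iff.1 hα)
    have h2 : α i ≤ α.degree := Finsupp.le_degree i α
    exact Nat.lt_succ_of_le (h2.trans h1.le)
  refine h.trans ?_
  rw [Fintype.card_piFinset_const, Finset.card_range, ← pow_mul, mul_comm, pow_mul]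
  exact Nat.pow_le_pow_left Nat.lt_two_pow_self _

/-- Decay of the homogeneous Taylor polynomials of an entire function of finite order. -/
theorem apolarNorm_homPart_taylor_le {d : ℕ} (f : entire d) {ρ : ℝ} (hρ : 0 < ρ)
    (h : HasGrowth f.1 ρ) : ∃ A B : ℝ, 0 < B ∧ ∀ m, apolarNorm (homPart m (taylor f)) ≤
      A * B ^ m * (m.factorial : ℝ) ^ (1 / 2 - 1 / ρ) := by
  obtain ⟨A, hA⟩ := h
  have hA0 : 0 ≤ A := nonneg_of_mul_nonneg_left ((norm_nonneg _).trans (hA 0)) (Real.exp_pos _)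
  set D : ℝ := Real.exp ((d : ℝ) ^ ρ) with hD
  have hD0 : 0 < D := Real.exp_pos _
  refine ⟨A * D, 2 ^ d * D, by positivity, fun m => ?_⟩
  have hf : (0 : ℝ) < m.factorial := by exact_mod_cast m.factorial_pos
  set G : ℝ := A * D ^ (m + 1) * (m.factorial : ℝ) ^ (-(1 / ρ)) with hG
  have hG0 : 0 ≤ G := by positivity
  have hcoeff : ∀ α : Fin d →₀ ℕ, ‖(homPart m (taylor f)).coeff α‖ ≤ G := by
    intro α
    rw [coeff_homPart]
    split_ifs with hα
    swap
    · simpa using hG0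
    -- This radius makes `exp((d r)^ρ) = D^{m+1}`, while `r^m ≥ m!^{1/ρ}`; `m + 1` keeps it positive
    -- at `m = 0`.
    set r : ℝ := ((m : ℝ) + 1) ^ (1 / ρ) with hr
    have hr0 : 0 < r := by positivity
    have hrρ : r ^ ρ = (m : ℝ) + 1 := by
      rw [hr, ← Real.rpow_mul (by positivity), one_div_mul_cancel hρ.ne', Real.rpow_one]
    have h1 := norm_mderiv_le f α (M := A * D ^ (m + 1)) hr0 fun z hz => by
      refine (hA z).trans ?_
      rw [hD, ← Real.exp_nat_mul]
      gcongr
      calc ‖z‖ ^ ρ ≤ (d * r) ^ ρ := by gcongr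
        _ = _ := by
          rw [Real.mul_rpow (by positivity) hr0.le, hrρ]
          push_cast
          ring
    have hαpos : (0 : ℝ) < multiFactorial α := by exact_mod_cast multiFactorial_pos α
    rw [coeff_taylor, norm_div, Complex.norm_natCast, div_le_iff₀ hαpos]
    refine h1.trans ?_
    rw [hα]
    change (multiFactorial α : ℝ) / r ^ m * (A * D ^ (m + 1)) ≤ G * multiFactorial α
    have h2 : (m.factorial : ℝ) ^ (1 / ρ) ≤ r ^ m := by
      have h3 : (m.factorial : ℝ) ≤ ((m : ℝ) + 1) ^ m := by
        exact_mod_cast m.factorial_le_pow.trans (Nat.pow_le_pow_left m.le_succ _)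
      calc (m.factorial : ℝ) ^ (1 / ρ) ≤ (((m : ℝ) + 1) ^ m) ^ (1 / ρ) := by gcongr
        _ = r ^ m := by
          rw [hr, ← Real.rpow_natCast, ← Real.rpow_natCast, ← Real.rpow_mul (by positivity),
            ← Real.rpow_mul (by positivity), mul_comm]
    have h4 : (r ^ m)⁻¹ ≤ (m.factorial : ℝ) ^ (-(1 / ρ)) := by
      rw [Real.rpow_neg hf.le]
      gcongr
    calc (multiFactorial α : ℝ) / r ^ m * (A * D ^ (m + 1))
        = A * D ^ (m + 1) * (r ^ m)⁻¹ * multiFactorial α := by ring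
      _ ≤ A * D ^ (m + 1) * (m.factorial : ℝ) ^ (-(1 / ρ)) * multiFactorial α := by gcongr
  have hsq : apolarSq (homPart m (taylor f)) ≤
      ((2 ^ d) ^ m * (m.factorial : ℝ) ^ (1 / 2 : ℝ) * G) ^ 2 := by
    have hp := isHomogeneous_homPart m (taylor f)
    calc apolarSq (homPart m (taylor f))
        ≤ ∑ α ∈ (homPart m (taylor f)).support, (m.factorial : ℝ) * G ^ 2 := by
          refine Finset.sum_le_sum fun α hα => ?_
          have h1 := multiFactorial_le α
          rw [degree_eq_of_coeff_ne_zero hp (mem_support_iff.1 hα)] at h1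
          have h2 : (multiFactorial α : ℝ) ≤ m.factorial := by exact_mod_cast h1
          have h3 := hcoeff α
          gcongr
      _ = (homPart m (taylor f)).support.card * ((m.factorial : ℝ) * G ^ 2) := by simp
      _ ≤ ((2 ^ d) ^ m) ^ 2 * ((m.factorial : ℝ) * G ^ 2) := by
          have h4 : ((homPart m (taylor f)).support.card : ℝ) ≤ (2 ^ d) ^ m := by
            exact_mod_cast card_support_le hp
          have h5 : (1 : ℝ) ≤ (2 ^ d) ^ m := one_le_pow₀ (one_le_pow₀ (by norm_num))
          gcongr
          exact h4.trans (le_self_pow₀ h5 two_ne_zero)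
      _ = _ := by
          rw [← Real.sqrt_eq_rpow, mul_pow _ G, mul_pow (_ ^ m), Real.sq_sqrt hf.le, mul_assoc]
  rw [apolarNorm_eq_sqrt]
  refine (Real.sqrt_le_iff.2 ⟨by positivity, hsq⟩).trans (le_of_eq ?_)
  rw [hG, sub_eq_add_neg, Real.rpow_add hf]
  ring

end FischerUniqueness

end

/-! ### From the recursion to uniqueness. -/

noncomputable section

namespace FischerUniqueness

open MvPolynomial

theorem apolarNorm_mul_le {d j : ℕ} {p : MvPolynomial (Fin d) ℂ} (hp : p.IsHomogeneous j) :
    ∃ K : ℝ, 0 ≤ K ∧ ∀ (m : ℕ) (g : MvPolynomial (Fin d) ℂ), g.IsHomogeneous m →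
      apolarNorm (p * g) ≤ K * ((m : ℝ) + j) ^ ((j : ℝ) / 2) * apolarNorm g := by
  obtain ⟨K, hK, h⟩ := apolarSq_mul_le hp
  refine ⟨Real.sqrt K, Real.sqrt_nonneg K, fun m g hg => ?_⟩
  have hg0 := apolarNorm_nonneg g
  rw [apolarNorm_eq_sqrt (p * g)]
  refine Real.sqrt_le_iff.2 ⟨by positivity, (h m g hg).trans (le_of_eq ?_)⟩
  rw [mul_pow, mul_pow, Real.sq_sqrt hK, apolarNorm_sq, ← Real.rpow_mul_natCast (by positivity)]
  norm_num

theorem orderBound_pos {k β₁ β₂ : ℕ} {τ : ℝ} (h₁₂ : β₁ ≤ β₂) (h₂ : β₂ < k)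
    (hτ : τ ≤ (k : ℝ) - 1) : 0 < orderBound k β₁ β₂ τ := by
  have h1 : (β₁ : ℝ) ≤ β₂ := by exact_mod_cast h₁₂
  have h2 : (β₂ : ℝ) < k := by exact_mod_cast h₂
  unfold orderBound
  split_ifs <;> exact div_pos (by linarith) (by linarith)

/-- If `τ ≤ β₂`, the quotient `(j-τ)/(k-j)` increases with `j`, so `j = β₂` is the worst case.
Otherwise `c` is negative, and `j - τ ≤ β₂ - τ` together with `k - j ≤ k - β₁` suffices. -/
theorem exponent_le_of_orderBound {k β₁ β₂ j : ℕ} {τ : ℝ} (hj₁ : β₁ ≤ j) (hj₂ : j ≤ β₂)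
    (h₂ : β₂ < k) (hτ : τ ≤ (k : ℝ) - 1) :
    ((j : ℝ) - τ) / 2 ≤ (1 / orderBound k β₁ β₂ τ - 1 / 2) * (k - j) := by
  have h1 : (β₁ : ℝ) ≤ j := by exact_mod_cast hj₁
  have h2 : (j : ℝ) ≤ β₂ := by exact_mod_cast hj₂
  have h3 : (β₂ : ℝ) < k := by exact_mod_cast h₂
  unfold orderBound
  split_ifs with h
  · have h4 : 0 < (k : ℝ) - β₂ := by linarith
    have h5 : 1 / (2 * ((k : ℝ) - β₂) / (k - τ)) - 1 / 2 = (β₂ - τ) / (2 * (k - β₂)) := by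
      field_simp
      ring
    rw [h5, div_mul_eq_mul_div, div_le_div_iff₀ two_pos (by linarith)]
    nlinarith
  · push Not at h
    have h4 : 0 < (k : ℝ) - β₁ := by linarith
    have h5 : 1 / (2 * ((k : ℝ) - β₁) / (k + β₂ - β₁ - τ)) - 1 / 2 =
        (β₂ - τ) / (2 * (k - β₁)) := by
      field_simp
      ring
    rw [h5, div_mul_eq_mul_div, div_le_div_iff₀ two_pos (by linarith)]
    nlinarith

/-- The recursive inequality satisfied by the Taylor polynomials of a solution. -/
theorem apolarNorm_homPart_le {d k : ℕ} {J : Finset ℕ} (hJ : ∀ j ∈ J, j ≤ k)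
    {P : MvPolynomial (Fin d) ℂ}
    (hP : P = (∑ j ∈ J, homogeneousComponent j P) + homogeneousComponent k P) {f : entire d}
    (h : polyOp (conjPoly (homogeneousComponent k P)) (mulPoly P f) = 0) (n : ℕ) :
    apolarNorm (homogeneousComponent k P * homPart n (taylor f)) ≤
      ∑ j ∈ J, apolarNorm (homogeneousComponent j P * homPart (n + (k - j)) (taylor f)) := by
  set q := homogeneousComponent k P * homPart n (taylor f) with hq
  have hhom : q.IsHomogeneous (n + k) := by
    rw [add_comm]
    exact (homogeneousComponent_isHomogeneous k P).mul (isHomogeneous_homPart n _)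
  have h0 := apolarInner_homPart_taylor_eq_zero hhom h
  have hexpand : homPart (n + k) (taylor (mulPoly P f)) =
      (∑ j ∈ J, homogeneousComponent j P * homPart (n + (k - j)) (taylor f)) + q := by
    rw [taylor_mulPoly]
    conv_lhs => rw [hP]
    rw [coe_add, add_mul, homPart_add, homPart_mul (homogeneousComponent_isHomogeneous k P)]
    congr 1
    rw [← coeToMvPowerSeries.ringHom_apply, map_sum, Finset.sum_mul, homPart_sum]
    refine Finset.sum_congr rfl fun j hj => ?_
    have hjk := hJ j hj
    rw [show n + k = n + (k - j) + j by omega]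
    exact homPart_mul (homogeneousComponent_isHomogeneous j P) _
  rw [← hq, hexpand, apolarInner_add_left, apolarInner_sum_left, apolarInner_self,
    ← apolarNorm_sq] at h0
  have h1 : apolarNorm q ^ 2 ≤ (∑ j ∈ J, apolarNorm (homogeneousComponent j P *
      homPart (n + (k - j)) (taylor f))) * apolarNorm q := by
    calc apolarNorm q ^ 2 = ‖((apolarNorm q ^ 2 : ℝ) : ℂ)‖ := by
          rw [Complex.norm_real, Real.norm_of_nonneg (sq_nonneg _)]
      _ = ‖∑ j ∈ J, apolarInner (homogeneousComponent j P *
            homPart (n + (k - j)) (taylor f)) q‖ := by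
          rw [eq_neg_of_add_eq_zero_left h0, norm_neg]
      _ ≤ _ := by
          rw [Finset.sum_mul]
          exact (norm_sum_le _ _).trans (Finset.sum_le_sum fun j _ => norm_apolarInner_le _ _)
  rcases (apolarNorm_nonneg q).eq_or_lt with hq0 | hq0
  · rw [← hq0]
    exact Finset.sum_nonneg fun j _ => apolarNorm_nonneg _
  · rw [sq] at h1
    exact le_of_mul_le_mul_right h1 hq0

theorem eq_zero_of_hasGrowth {d k β₁ β₂ : ℕ} (hβ₂ : β₂ < k) {P : MvPolynomial (Fin d) ℂ}
    (hP : P = (∑ j ∈ Finset.Icc β₁ β₂, homogeneousComponent j P) + homogeneousComponent k P)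
    {τ C : ℝ} (hτ : τ ≤ (k : ℝ) - 1) (hC : 0 < C)
    (hKS : ∀ (m : ℕ) (g : MvPolynomial (Fin d) ℂ), g.IsHomogeneous m →
      C * ((m : ℝ) + 1) ^ (τ / 2) * apolarNorm g ≤ apolarNorm (homogeneousComponent k P * g))
    {f : entire d} {ρ : ℝ} (hρ0 : 0 < ρ) (hρ : ρ < orderBound k β₁ β₂ τ)
    (hgrow : HasGrowth f.1 ρ)
    (h : polyOp (conjPoly (homogeneousComponent k P)) (mulPoly P f) = 0) : f = 0 := by
  set b := orderBound k β₁ β₂ τ with hb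
  obtain ⟨A, B, hB, hAB⟩ := apolarNorm_homPart_taylor_le f hρ0 hgrow
  have hJ : ∀ j ∈ Finset.Icc β₁ β₂, j < k := fun j hj =>
    (Finset.mem_Icc.1 hj).2.trans_lt hβ₂
  choose K hK0 hK using fun j => apolarNorm_mul_le (homogeneousComponent_isHomogeneous j P)
  set K' : ℝ := ∑ j ∈ Finset.Icc β₁ β₂, K j * (k : ℝ) ^ ((j : ℝ) / 2) with hK'
  have hterm : ∀ j, 0 ≤ K j * (k : ℝ) ^ ((j : ℝ) / 2) := fun j =>
    mul_nonneg (hK0 j) (Real.rpow_nonneg (Nat.cast_nonneg k) _)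
  refine eq_zero_of_homPart_taylor_eq_zero f fun m => eq_zero_of_apolarNorm_eq_zero ?_
  -- With these `c` and `ε`, the exponent `-c - ε` is exactly the decay exponent `1/2 - 1/ρ`.
  refine eq_zero_of_recursive_le (a := fun n => apolarNorm (homPart n (taylor f))) hJ
    (τ := τ) (c := 1 / b - 1 / 2) (ε := 1 / ρ - 1 / b) (K := K' / C) (A := A) (B := B)
    (sub_pos.2 (one_div_lt_one_div_of_lt hρ0 hρ))
    (div_nonneg (Finset.sum_nonneg fun j _ => hterm j) hC.le) hB
    (fun j hj => exponent_le_of_orderBound (Finset.mem_Icc.1 hj).1 (Finset.mem_Icc.1 hj).2 hβ₂ hτ)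
    (fun n => apolarNorm_nonneg _) (fun n => ?_) (fun n => ?_) m
  · have h1 := (hKS n _ (isHomogeneous_homPart n (taylor f))).trans
      (apolarNorm_homPart_le (fun j hj => (hJ j hj).le) hP h n)
    rw [div_mul_eq_mul_div, le_div_iff₀ hC]
    refine le_trans (le_of_eq (by ring)) (h1.trans ?_)
    rw [Finset.mul_sum]
    refine Finset.sum_le_sum fun j hj => ?_
    have hjk := hJ j hj
    refine (hK j _ _ (isHomogeneous_homPart (n + (k - j)) (taylor f))).trans ?_
    rw [← mul_assoc]
    refine mul_le_mul_of_nonneg_right ?_ (apolarNorm_nonneg _)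
    -- Trades the power of `n + k` for one of `n + 1`; this is the source of `k^{j/2}` in `K'`.
    have h2 : ((n + (k - j) : ℕ) : ℝ) + j ≤ k * ((n : ℝ) + 1) := by
      have : n + (k - j) + j ≤ k * (n + 1) := by
        rw [show n + (k - j) + j = n + k by omega]
        nlinarith
      exact_mod_cast this
    calc K j * (((n + (k - j) : ℕ) : ℝ) + j) ^ ((j : ℝ) / 2)
        ≤ K j * (k * ((n : ℝ) + 1)) ^ ((j : ℝ) / 2) := by
          have := hK0 j
          gcongr
      _ = K j * (k : ℝ) ^ ((j : ℝ) / 2) * ((n : ℝ) + 1) ^ ((j : ℝ) / 2) := by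
          rw [Real.mul_rpow (by positivity) (by positivity), mul_assoc]
      _ ≤ K' * ((n : ℝ) + 1) ^ ((j : ℝ) / 2) := by
          gcongr
          exact Finset.single_le_sum (f := fun j => K j * (k : ℝ) ^ ((j : ℝ) / 2))
            (fun j _ => hterm j) hj
  · refine (hAB n).trans (le_of_eq ?_)
    congr 2
    ring

/-- If `P φ - P ψ` is annihilated by `P_k^*(D)` and `φ`, `ψ` have low order, then `φ = ψ`. -/
theorem eq_of_diffOp_eq {d k β₁ β₂ : ℕ} (hβ₁₂ : β₁ ≤ β₂) (hβ₂ : β₂ < k)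
    {P : MvPolynomial (Fin d) ℂ}
    (hP : P = (∑ j ∈ Finset.Icc β₁ β₂, homogeneousComponent j P) + homogeneousComponent k P)
    {τ C : ℝ} (hτ : τ ≤ (k : ℝ) - 1) (hC : 0 < C)
    (hKS : ∀ (m : ℕ) (g : MvPolynomial (Fin d) ℂ), g.IsHomogeneous m →
      C * ((m : ℝ) + 1) ^ (τ / 2) * apolarNorm g ≤ apolarNorm (homogeneousComponent k P * g))
    {φ ψ : Cd d → ℂ} (hφ : φ ∈ entireOfOrderLT d (orderBound k β₁ β₂ τ))
    (hψ : ψ ∈ entireOfOrderLT d (orderBound k β₁ β₂ τ))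
    (h : diffOp (conjPoly (homogeneousComponent k P)) (fun z => evalAt P z * φ z) =
      diffOp (conjPoly (homogeneousComponent k P)) (fun z => evalAt P z * ψ z)) : φ = ψ := by
  have hb := orderBound_pos hβ₁₂ hβ₂ hτ
  obtain ⟨ρ, hρ0, hρb, hρ⟩ := exists_hasGrowth hφ.1.continuous hb hφ.2
  obtain ⟨σ, hσ0, hσb, hσ⟩ := exists_hasGrowth hψ.1.continuous hb hψ.2
  set F : entire d := ⟨φ, hφ.1⟩ with hF
  set G : entire d := ⟨ψ, hψ.1⟩ with hG
  have h0 : F - G = 0 := by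
    -- A common exponent `max ρ σ` bounds the difference, so the order of a difference is never
    -- needed.
    refine eq_zero_of_hasGrowth hβ₂ hP hτ hC hKS (lt_max_of_lt_left hρ0) (max_lt hρb hσb)
      ((hρ.mono hρ0 (le_max_left ρ σ)).sub (hσ.mono hσ0 (le_max_right ρ σ))) ?_
    rw [map_sub, map_sub, sub_eq_zero]
    refine Subtype.ext ?_
    rw [coe_polyOp, coe_polyOp]
    exact h
  exact congrArg Subtype.val (sub_eq_zero.1 h0)

theorem diffOp_zero {d : ℕ} (Q : MvPolynomial (Fin d) ℂ) : diffOp Q 0 = 0 := by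
  have := coe_polyOp Q (0 : entire d)
  rw [map_zero] at this
  exact this.symm

theorem diffOp_sub {d : ℕ} (Q : MvPolynomial (Fin d) ℂ) {f g : Cd d → ℂ}
    (hf : Differentiable ℂ f) (hg : Differentiable ℂ g) :
    diffOp Q (f - g) = diffOp Q f - diffOp Q g := by
  have := coe_polyOp Q ((⟨f, hf⟩ : entire d) - ⟨g, hg⟩)
  rw [map_sub] at this
  rw [← coe_polyOp Q ⟨f, hf⟩, ← coe_polyOp Q ⟨g, hg⟩]
  exact this.symm

theorem zero_mem_entireOfOrderLT (d : ℕ) {b : ℝ} (hb : 0 < b) :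
    (0 : Cd d → ℂ) ∈ entireOfOrderLT d b := by
  refine ⟨differentiable_const 0, ?_⟩
  have h : ∀ r, maxModulus (0 : Cd d → ℂ) r = 0 := by
    intro r
    refine le_antisymm (Real.sSup_le ?_ le_rfl) (Real.sSup_nonneg ?_)
    · rintro _ ⟨z, -, rfl⟩
      simp
    · rintro _ ⟨z, -, rfl⟩
      simp
  simpa [entireOrder, h] using hb

end FischerUniqueness

end

theorem mainTheorem1 (d k β₁ β₂ : ℕ) (hk : 2 ≤ k) (hβ₁₂ : β₁ ≤ β₂) (hβ₂ : β₂ ≤ k - 1)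
    (P : MvPolynomial (Fin d) ℂ) (hdeg : P.totalDegree = k)
    (hP : P = (∑ j ∈ Finset.Icc β₁ β₂, MvPolynomial.homogeneousComponent j P)
      + MvPolynomial.homogeneousComponent k P)
    (hP₁ : MvPolynomial.homogeneousComponent β₁ P ≠ 0)
    (hP₂ : MvPolynomial.homogeneousComponent β₂ P ≠ 0)
    (τ C : ℝ) (hτ₀ : 0 ≤ τ) (hτ : τ ≤ (k : ℝ) - 1) (hC : 0 < C)
    (hKS : ∀ (m : ℕ) (g : MvPolynomial (Fin d) ℂ), g.IsHomogeneous m →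
      FischerUniqueness.apolarNorm (MvPolynomial.homogeneousComponent k P * g)
        ≥ C * ((m : ℝ) + 1) ^ (τ / 2) * FischerUniqueness.apolarNorm g) :
    -- an entire solution of low order vanishes
    (∀ φ : FischerUniqueness.Cd d → ℂ, Differentiable ℂ φ →
      FischerUniqueness.entireOrder φ
        < ((FischerUniqueness.orderBound k β₁ β₂ τ : ℝ) : EReal) →
      FischerUniqueness.diffOp
        (FischerUniqueness.conjPoly (MvPolynomial.homogeneousComponent k P))
        (fun z => FischerUniqueness.evalAt P z * φ z) = 0 →
      φ = 0) ∧
    -- the Fischer operator is injective on the entire functions of low order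
    Set.InjOn
      (FischerUniqueness.fischerOp
        (FischerUniqueness.conjPoly (MvPolynomial.homogeneousComponent k P)) P)
      (FischerUniqueness.entireOfOrderLT d (FischerUniqueness.orderBound k β₁ β₂ τ)) ∧
    -- Fischer decompositions `f = P q + r` with `q` of low order are unique
    (∀ f q₁ q₂ r₁ r₂ : FischerUniqueness.Cd d → ℂ,
      q₁ ∈ FischerUniqueness.entireOfOrderLT d (FischerUniqueness.orderBound k β₁ β₂ τ) →
      q₂ ∈ FischerUniqueness.entireOfOrderLT d (FischerUniqueness.orderBound k β₁ β₂ τ) →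
      Differentiable ℂ r₁ → Differentiable ℂ r₂ →
      (∀ z, f z = FischerUniqueness.evalAt P z * q₁ z + r₁ z) →
      (∀ z, f z = FischerUniqueness.evalAt P z * q₂ z + r₂ z) →
      FischerUniqueness.diffOp
        (FischerUniqueness.conjPoly (MvPolynomial.homogeneousComponent k P)) r₁ = 0 →
      FischerUniqueness.diffOp
        (FischerUniqueness.conjPoly (MvPolynomial.homogeneousComponent k P)) r₂ = 0 →
      q₁ = q₂ ∧ r₁ = r₂) := by
  have hβ : β₂ < k := by omega
  have heq := fun φ ψ => FischerUniqueness.eq_of_diffOp_eq hβ₁₂ hβ hP hτ hC hKS (φ := φ) (ψ := ψ)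
  have hb := FischerUniqueness.orderBound_pos hβ₁₂ hβ hτ
  refine ⟨fun φ hφ hord h => ?_, fun φ hφ ψ hψ h => heq φ ψ hφ hψ h, ?_⟩
  · refine heq φ 0 ⟨hφ, hord⟩ (FischerUniqueness.zero_mem_entireOfOrderLT d hb) ?_
    rw [h, show (fun z => FischerUniqueness.evalAt P z * (0 : FischerUniqueness.Cd d → ℂ) z) = 0
      from funext fun z => mul_zero _, FischerUniqueness.diffOp_zero]
  · intro f q₁ q₂ r₁ r₂ hq₁ hq₂ hr₁ hr₂ h₁ h₂ hd₁ hd₂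
    have hP' := FischerUniqueness.differentiable_evalAt P
    -- `P q₁ - P q₂ = r₂ - r₁` is annihilated by `P_k^*(D)`, which reduces the claim to injectivity.
    have hdiff : (fun z => FischerUniqueness.evalAt P z * q₁ z) -
        (fun z => FischerUniqueness.evalAt P z * q₂ z) = r₂ - r₁ := by
      funext z
      have := (h₁ z).symm.trans (h₂ z)
      simp only [Pi.sub_apply]
      linear_combination this
    have hq : q₁ = q₂ := by
      refine heq q₁ q₂ hq₁ hq₂ (sub_eq_zero.1 ?_)
      rw [← FischerUniqueness.diffOp_sub _ (hP'.fun_mul hq₁.1) (hP'.fun_mul hq₂.1), hdiff,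
        FischerUniqueness.diffOp_sub _ hr₂ hr₁, hd₁, hd₂, sub_zero]
    refine ⟨hq, ?_⟩
    subst hq
    rw [sub_self] at hdiff
    exact (sub_eq_zero.1 hdiff.symm).symm
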